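/- Let $\rho$ be a probability distribution on $\mathbb{R}$ with finite fourth moment, let $m_1=\int x\,d\rho(x)$ be its mean, which may be arbitrary, and let $\mu_q=\int (x-m_1)^q\,d\rho(x)$, $q=2,3,4$, be its central moments. For each $n\ge 0$ let $X^{(n)}$ be a random real symmetric $n\times n$ matrix whose entries $X_{ij}$, $1\le i\le j\le n$, on and above the diagonal are independent with common distribution $\rho$. Then $f_2(n)=\mathbb{E}[\det(X^{(n)})^2]$ is finite for every $n\ge 0$ (with $f_2(0)=1$), and the exponential generating function $F_2(t)=\sum_{n=0}^{\infty} f_2(n)\frac{t^n}{n!}$ converges for every real $t$ with $|\mu_2 t|<1$ and equals $$F_2(t)=\left(1+2m_1\mu_3t^2+m_1^2\left(\mu_3^2t^4+\frac{t}{1-\mu_2^2t^2}+\frac{2\mu_2t^2}{1-\mu_2t}\right)\right)\frac{\exp\left(\frac{(\mu_4-3\mu_2^2)t^2}{2}-\mu_2t\right)}{(1-\mu_2t)^2\sqrt{1-\mu_2^2t^2}}.$$ -/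

import Mathlib

open MeasureTheory ProbabilityTheory

/-- `X` is a random real symmetric `n × n` matrix, defined on the probability space `(Ω, P)`,
whose entries on and above the diagonal are independent, all with distribution `ρ`. -/
structure IsIIDSymmetric {Ω : Type*} [MeasurableSpace Ω] {n : ℕ} (ρ : Measure ℝ)
    (P : Measure Ω) (X : Ω → Matrix (Fin n) (Fin n) ℝ) : Prop where
  symm : ∀ ω, (X ω).IsSymm
  hasLaw : ∀ i j : Fin n, i ≤ j → HasLaw (fun ω => X ω i j) ρ P
  indep : iIndepFun (fun (p : {p : Fin n × Fin n // p.1 ≤ p.2}) ω => X ω p.1.1 p.1.2) P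

/-- The `k`-th moment `E[det(X)^k]` of the determinant of a random square matrix. -/
noncomputable def detMoment {Ω : Type*} [MeasurableSpace Ω] {n : ℕ} (k : ℕ)
    (P : Measure Ω) (X : Ω → Matrix (Fin n) (Fin n) ℝ) : ℝ :=
  ∫ ω, (X ω).det ^ k ∂P

/-!
The determinant squared has degree at most four in each independent entry, so a quadrature rule
exact to degree four may replace `ρ` and expectations become finite sums. Translating the rule by
the mean makes it centred; conversely, adding the constant `m₁` to every entry perturbs the matrix
by rank one, so `det (Y + m₁ J) = det Y + m₁ ∑ᵢⱼ adj(Y)ᵢⱼ`, and the non-centred second moment is a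
combination of moments of `det Y` and of the cofactors of the centred matrix `Y`.

Expanding a centred matrix along a row and column, whose entries are independent of the rest, gives
a closed recursion for three sequences: the second moment of the determinant, the second moment of
an off-diagonal cofactor, and the mixed moment of two diagonal cofactors. For the exponential
generating functions `A`, `B`, `C` it reads `B = μ₂ (A + t B)`, `C = μ₂² (t A + t² C)` and
`A' = μ₂ A + μ₄ t A + μ₂² (t² C + 2 t² B)`. Solving for `B` and `C` leaves a first-order linear
equation for `A`. Its solution is holomorphic where `|μ₂ t| < 1`, so its Taylor series converges
there, and the recursion determines the Taylor coefficients.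
-/

open Finset Matrix

/-- A signed law on a commutative ring `R` with finite support: weight `weight k` sits at
`node k`. A quadrature rule is such a law, and lets expectations of polynomials be handled as
finite sums. -/
structure SignedLaw (K R : Type*) where
  weight : K → R
  node : K → R

theorem dotProduct_mulVec_self {ι R : Type*} [Fintype ι] [CommSemiring R] (x : ι → R)
    (N : Matrix ι ι R) : x ⬝ᵥ N *ᵥ x = ∑ i, ∑ j, x i * x j * N i j := by
  simp only [dotProduct, mulVec, mul_sum, mul_assoc, mul_comm (N _ _)]

namespace SignedLaw

section Expectation

variable {K R : Type*} [Fintype K] [CommRing R] (ν : SignedLaw K R)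

/-- The mean of `f` under the signed law `ν`. -/
def mean (f : R → R) : R := ∑ k, ν.weight k * f (ν.node k)

/-- The `n`-th moment of the signed law `ν`. -/
def moment (n : ℕ) : R := ν.mean (· ^ n)

/-- The law `ν` shifted by `c`. -/
def translate (c : R) : SignedLaw K R where
  weight := ν.weight
  node k := ν.node k + c

/-- The mean of `f` over a family of independent coordinates of law `ν` each. -/
def expect {ι : Type*} [Fintype ι] [DecidableEq ι] (f : (ι → R) → R) : R :=
  ∑ x : ι → K, (∏ i, ν.weight (x i)) * f fun i => ν.node (x i)

theorem mean_add (f g : R → R) : ν.mean (fun x => f x + g x) = ν.mean f + ν.mean g := by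
  simp only [mean, mul_add, sum_add_distrib]

theorem mean_sub (f g : R → R) : ν.mean (fun x => f x - g x) = ν.mean f - ν.mean g := by
  simp only [mean, mul_sub, sum_sub_distrib]

theorem mean_mul_const (f : R → R) (c : R) : ν.mean (fun x => f x * c) = ν.mean f * c := by
  simp only [mean, sum_mul, mul_assoc]

theorem mean_const_mul (c : R) (f : R → R) : ν.mean (fun x => c * f x) = c * ν.mean f := by
  simp only [mul_comm c, mean_mul_const]

variable {ι κ : Type*} [Fintype ι] [DecidableEq ι] [Fintype κ] [DecidableEq κ]

theorem expect_add (f g : (ι → R) → R) :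
    ν.expect (fun x => f x + g x) = ν.expect f + ν.expect g := by
  simp only [expect, mul_add, sum_add_distrib]

theorem expect_const_mul (c : R) (f : (ι → R) → R) :
    ν.expect (fun x => c * f x) = c * ν.expect f := by
  simp only [expect, mul_sum, mul_left_comm c]

theorem expect_mul_const (f : (ι → R) → R) (c : R) :
    ν.expect (fun x => f x * c) = ν.expect f * c := by
  simp only [mul_comm _ c, expect_const_mul]

theorem expect_neg (f : (ι → R) → R) : ν.expect (fun x => -f x) = -ν.expect f := by
  simp only [expect, mul_neg, sum_neg_distrib]

theorem expect_sum {α : Type*} (s : Finset α) (f : α → (ι → R) → R) :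
    ν.expect (fun x => ∑ a ∈ s, f a x) = ∑ a ∈ s, ν.expect (f a) := by
  simp only [expect, mul_sum]
  exact sum_comm

theorem expect_prod (g : ι → R → R) : ν.expect (fun x => ∏ i, g i (x i)) = ∏ i, ν.mean (g i) := by
  simp only [mean, Fintype.prod_sum, expect, prod_mul_distrib]

theorem expect_equiv (e : ι ≃ κ) (f : (ι → R) → R) :
    ν.expect f = ν.expect fun y : κ → R => f fun i => y (e i) := by
  simp only [expect]
  rw [← (e.arrowCongr (Equiv.refl K)).symm.sum_comp]
  refine sum_congr rfl fun x _ => ?_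
  congr 1
  exact e.prod_comp fun i => ν.weight (x i)

theorem expect_sumElim (f : (ι ⊕ κ → R) → R) :
    ν.expect f = ν.expect fun y : κ → R => ν.expect fun x : ι → R => f (Sum.elim x y) := by
  simp only [expect, mul_sum]
  rw [← (Equiv.sumArrowEquivProdArrow ι κ K).symm.sum_comp, Fintype.sum_prod_type_right]
  refine sum_congr rfl fun y _ => sum_congr rfl fun x _ => ?_
  rw [Fintype.prod_sum_type, mul_left_comm, ← mul_assoc]
  congr 2
  ext (i | i) <;> rfl

theorem expect_option (f : (Option ι → R) → R) :
    ν.expect f = ν.expect fun x : ι → R => ν.mean fun a => f fun o => o.elim a x := by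
  simp only [expect, mean, mul_sum]
  rw [← (Equiv.piOptionEquivProd (β := fun _ => K)).symm.sum_comp, Fintype.sum_prod_type_right]
  refine sum_congr rfl fun x _ => sum_congr rfl fun a _ => ?_
  rw [Fintype.prod_option, mul_left_comm, ← mul_assoc]
  congr 2
  ext (_ | i) <;> rfl

theorem expect_multiset_prod (s : Multiset ι) :
    ν.expect (fun x => (s.map x).prod) = ∏ i, ν.moment (s.count i) := by
  simp only [moment, ← expect_prod, prod_multiset_map_count]
  congr! 2 with x
  refine prod_subset (subset_univ _) fun i _ hi => ?_
  rw [Multiset.count_eq_zero.2 (by simpa using hi), pow_zero]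

end Expectation

section Centered

variable {K R : Type*} [Fintype K] [CommRing R] {ν : SignedLaw K R}

/-- The signed law `ν` has total mass one and mean zero. -/
structure IsCentered (ν : SignedLaw K R) : Prop where
  moment_zero : ν.moment 0 = 1
  moment_one : ν.moment 1 = 0

namespace IsCentered

theorem mean_const (h : ν.IsCentered) (c : R) : ν.mean (fun _ => c) = c := by
  simpa only [moment, pow_zero, ← mean_mul_const, one_mul] using congr_arg (· * c) h.moment_zero

theorem mean_affine (h : ν.IsCentered) (c d : R) : ν.mean (fun a => a * c - d) = -d := by
  have mean_id : ν.mean (fun a => a) = 0 := by simpa only [moment, pow_one] using h.moment_one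
  rw [mean_sub, mean_mul_const, mean_id, h.mean_const, zero_mul, zero_sub]

theorem mean_affine_mul_affine (h : ν.IsCentered) (c d c' d' : R) :
    ν.mean (fun a => (a * c - d) * (a * c' - d')) = ν.moment 2 * (c * c') + d * d' := by
  have expand (a : R) : (a * c - d) * (a * c' - d') =
      a ^ 2 * (c * c') + (a * (-(c * d') - d * c') - -(d * d')) := by ring
  simp only [expand, mean_add, mean_mul_const, h.mean_affine, neg_neg, moment]

variable {ι : Type*} [Fintype ι] [DecidableEq ι]

theorem expect_multiset_prod (h : ν.IsCentered) (s : Multiset ι) :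
    ν.expect (fun x => (s.map x).prod) = ∏ i ∈ s.toFinset, ν.moment (s.count i) := by
  rw [ν.expect_multiset_prod]
  refine (prod_subset (subset_univ _) fun i _ hi => ?_).symm
  rw [Multiset.count_eq_zero.2 (by simpa using hi), h.moment_zero]

theorem expect_multiset_prod_eq_zero (h : ν.IsCentered) {s : Multiset ι} {i : ι}
    (hi : s.count i = 1) : ν.expect (fun x => (s.map x).prod) = 0 := by
  rw [ν.expect_multiset_prod]
  exact prod_eq_zero (mem_univ i) (by rw [hi, h.moment_one])

theorem expect_const (h : ν.IsCentered) (c : R) : ν.expect (fun _ : ι → R => c) = c := by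
  have key := h.expect_multiset_prod (0 : Multiset ι)
  simp only [Multiset.map_zero, Multiset.prod_zero, Multiset.toFinset_zero, prod_empty] at key
  simpa [key] using ν.expect_const_mul c fun _ : ι → R => 1

theorem expect_coord (h : ν.IsCentered) (i : ι) : ν.expect (fun x => x i) = 0 := by
  simpa using h.expect_multiset_prod_eq_zero (s := {i}) (i := i) (by simp)

theorem expect_coord₂ (h : ν.IsCentered) (i j : ι) :
    ν.expect (fun x => x i * x j) = if i = j then ν.moment 2 else 0 := by
  have key := h.expect_multiset_prod {i, j}
  simp only [Multiset.insert_eq_cons, Multiset.map_cons, Multiset.prod_cons,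
    Multiset.map_singleton, Multiset.prod_singleton] at key
  rw [key]
  split_ifs with hij
  · simp [hij]
  · simp [hij, h.moment_one]

theorem expect_coord₃ (h : ν.IsCentered) (i j k : ι) :
    ν.expect (fun x => x i * (x j * x k)) =
      if i = j then if i = k then ν.moment 3 else 0 else 0 := by
  have key := h.expect_multiset_prod {i, j, k}
  simp only [Multiset.insert_eq_cons, Multiset.map_cons, Multiset.prod_cons,
    Multiset.map_singleton, Multiset.prod_singleton] at key
  rw [key]
  clear key
  by_cases hij : i = j <;> by_cases hik : i = k <;> by_cases hjk : j = k <;>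
    subst_vars <;> simp_all [h.moment_one, Multiset.count_cons, prod_insert, eq_comm]

theorem expect_coord₄ (h : ν.IsCentered) (i j k l : ι) :
    ν.expect (fun x => x i * (x j * (x k * x l))) =
      (if i = j then if k = l then ν.moment 2 ^ 2 else 0 else 0)
      + (if i = k then if j = l then ν.moment 2 ^ 2 else 0 else 0)
      + (if i = l then if j = k then ν.moment 2 ^ 2 else 0 else 0)
      + (if i = j then if j = k then if k = l then ν.moment 4 - 3 * ν.moment 2 ^ 2
          else 0 else 0 else 0) := by
  have key := h.expect_multiset_prod {i, j, k, l}
  simp only [Multiset.insert_eq_cons, Multiset.map_cons, Multiset.prod_cons,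
    Multiset.map_singleton, Multiset.prod_singleton] at key
  rw [key]
  clear key
  by_cases hij : i = j <;> by_cases hik : i = k <;> by_cases hil : i = l <;>
    by_cases hjk : j = k <;> by_cases hjl : j = l <;> by_cases hkl : k = l <;>
    subst_vars <;> simp_all [h.moment_one, Multiset.count_cons, prod_insert, eq_comm] <;> ring

theorem expect_dotProduct (h : ν.IsCentered) (c : ι → R) : ν.expect (fun x => x ⬝ᵥ c) = 0 := by
  simp only [dotProduct, expect_sum, expect_mul_const, h.expect_coord, zero_mul, sum_const_zero]

theorem expect_dotProduct_mul_dotProduct (h : ν.IsCentered) (c d : ι → R) :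
    ν.expect (fun x => (x ⬝ᵥ c) * (x ⬝ᵥ d)) = ν.moment 2 * (c ⬝ᵥ d) := by
  simp only [dotProduct, sum_mul_sum, mul_mul_mul_comm _ (c _), expect_sum, expect_mul_const,
    h.expect_coord₂]
  simp [mul_sum]

theorem expect_quadraticForm (h : ν.IsCentered) (N : Matrix ι ι R) :
    ν.expect (fun x => x ⬝ᵥ N *ᵥ x) = ν.moment 2 * N.trace := by
  simp only [dotProduct_mulVec_self, expect_sum, expect_mul_const, h.expect_coord₂]
  simp [mul_sum, trace]

theorem expect_dotProduct_mul_quadraticForm (h : ν.IsCentered) (c : ι → R) (N : Matrix ι ι R) :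
    ν.expect (fun x => (x ⬝ᵥ c) * (x ⬝ᵥ N *ᵥ x)) = ν.moment 3 * (c ⬝ᵥ N.diag) := by
  have regroup (x : ι → R) (l i j : ι) :
      x l * c l * (x i * x j * N i j) = x l * (x i * x j) * (c l * N i j) := by ring
  simp only [dotProduct_mulVec_self]
  simp only [dotProduct, sum_mul, mul_sum, regroup, expect_sum, expect_mul_const, h.expect_coord₃]
  simp

theorem expect_quadraticForm_mul_quadraticForm (h : ν.IsCentered) (M N : Matrix ι ι R) :
    ν.expect (fun x => (x ⬝ᵥ M *ᵥ x) * (x ⬝ᵥ N *ᵥ x)) =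
      ν.moment 2 ^ 2 * (M.trace * N.trace + (M * Nᵀ).trace + (M * N).trace)
        + (ν.moment 4 - 3 * ν.moment 2 ^ 2) * (M.diag ⬝ᵥ N.diag) := by
  have regroup (x : ι → R) (i j k l : ι) : x i * x j * M i j * (x k * x l * N k l) =
      x i * (x j * (x k * x l)) * (M i j * N k l) := by ring
  simp only [dotProduct_mulVec_self, trace]
  simp only [sum_mul_sum, regroup, expect_sum, expect_mul_const, h.expect_coord₄, add_mul,
    sum_add_distrib, ite_mul, zero_mul]
  simp [mul_sum, mul_add, mul_apply, dotProduct]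

end IsCentered

end Centered

end SignedLaw

section Border

variable {R V : Type*} [CommRing R] [Fintype V] [DecidableEq V]

/-- The matrix `Y` bordered by a corner entry `a`, a first column `u` and a first row `w`. -/
def border (a : R) (u w : V → R) (Y : Matrix V V R) : Matrix (Option V) (Option V) R
  | none, none => a
  | none, some j => w j
  | some i, none => u i
  | some i, some j => Y i j

theorem det_border_zero_row (a : R) (u : V → R) (Y : Matrix V V R) :
    (border a u 0 Y).det = a * Y.det := by
  have blocks : reindex (Equiv.optionEquivSumPUnit.{0} V) (Equiv.optionEquivSumPUnit.{0} V)
      (border a u 0 Y) = fromBlocks Y (of fun i _ => u i) 0 (of fun _ _ => a) := by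
    ext (i | i) (j | j) <;> rfl
  rw [← det_reindex_self (Equiv.optionEquivSumPUnit.{0} V), blocks, det_fromBlocks_zero₂₁,
    mul_comm, det_unique (n := PUnit), of_apply]

theorem adjugate_border_none_none (a : R) (u w : V → R) (Y : Matrix V V R) :
    (border a u w Y).adjugate none none = Y.det := by
  have row : (border a u w Y).updateRow none (Pi.single none 1) = border 1 u 0 Y := by
    ext (_ | i) (_ | j) <;> simp [updateRow_apply, border]
  rw [adjugate_apply, row, det_border_zero_row, one_mul]

theorem det_updateRow_eq_dotProduct (Y : Matrix V V R) (j : V) (w : V → R) :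
    (Y.updateRow j w).det = w ⬝ᵥ Y.adjugate.col j := by
  rw [← cramer_transpose_apply, cramer_eq_adjugate_mulVec, ← adjugate_transpose, mulVec_transpose]
  rfl

theorem adjugate_border_none_some (a : R) (u w : V → R) (Y : Matrix V V R) (k : V) :
    (border a u w Y).adjugate none (some k) = -(w ⬝ᵥ Y.adjugate.col k) := by
  set B := (border a u w Y).updateRow (some k) (Pi.single none 1)
  have swapRows : B.submatrix (Equiv.swap none (some k)) id =
      border 1 (Function.update u k a) 0 (Y.updateRow k w) := by
    have fix {i : V} (hi : i ≠ k) : Equiv.swap none (some k) (some i) = some i :=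
      Equiv.swap_apply_of_ne_of_ne (by simp) (by simpa using hi)
    ext (_ | i) (_ | j)
    · simp [B, border]
    · simp [B, border]
    all_goals
      rcases eq_or_ne i k with rfl | hi
      · simp [B, border]
      · simp [B, border, fix hi, updateRow_apply, hi]
  have sign := det_permute (Equiv.swap none (some k)) B
  rw [swapRows, det_border_zero_row, one_mul, Equiv.Perm.sign_swap (by simp)] at sign
  rw [adjugate_apply, ← det_updateRow_eq_dotProduct, sign]
  simp [B]

theorem det_border (a : R) (u w : V → R) (Y : Matrix V V R) :
    (border a u w Y).det = a * Y.det - w ⬝ᵥ Y.adjugate *ᵥ u := by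
  rw [det_eq_sum_mul_adjugate_col _ none, Fintype.sum_option, adjugate_border_none_none]
  simp only [adjugate_border_none_some, border, mul_neg, sum_neg_distrib, ← sub_eq_add_neg,
    dotProduct_mulVec]
  simp only [dotProduct, vecMul, col_apply, mul_comm]

theorem det_add_vecMulVec (Y : Matrix V V R) (u w : V → R) :
    (Y + vecMulVec u w).det = Y.det + w ⬝ᵥ Y.adjugate *ᵥ u := by
  have factor : border 1 (-u) w Y = border 1 (-u) 0 (Y + vecMulVec u w) * border 1 0 w 1 := by
    ext (_ | i) (_ | j) <;> simp [border, mul_apply, Fintype.sum_option, one_apply, vecMulVec]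
  have unipotent : (border 1 0 w (1 : Matrix V V R)).det = 1 := by simp [det_border]
  have key := congr_arg det factor
  rw [det_mul, unipotent, mul_one, det_border_zero_row, det_border] at key
  simpa [mulVec_neg] using key.symm

theorem det_add_const (Y : Matrix V V R) (m : R) :
    (Y + of fun _ _ => m).det = Y.det + m * ∑ i, ∑ j, Y.adjugate i j := by
  have rankOne : (of fun _ _ => m : Matrix V V R) = vecMulVec (fun _ => m) 1 := by
    ext; simp [vecMulVec]
  rw [rankOne, det_add_vecMulVec]
  simp [dotProduct, mulVec, mul_sum, mul_comm]

/-- The quadratic form by which the `(k, l)` cofactor of a symmetric bordered matrix depends on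
its border. Its diagonal entries are cofactors of size two less. -/
def borderForm (Y : Matrix V V R) (k l : V) : Matrix V V R :=
  (Y.updateRow l (Pi.single k 1)).adjugate.updateCol l 0

omit [Fintype V] in
theorem border_updateRow_some (a : R) (u w : V → R) (Y : Matrix V V R) (k l : V) :
    (border a u w Y).updateRow (some l) (Pi.single (some k) 1) =
      border a (Function.update u l 0) w (Y.updateRow l (Pi.single k 1)) := by
  ext (_ | i) (_ | j)
  · simp [border]
  · simp [border]
  all_goals rcases eq_or_ne i l with rfl | hi <;> simp [border, updateRow_apply, Pi.single_apply, *]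

theorem adjugate_border_some_some (a : R) (v : V → R) (Y : Matrix V V R) (k l : V) :
    (border a v v Y).adjugate (some k) (some l) =
      a * Y.adjugate k l - v ⬝ᵥ borderForm Y k l *ᵥ v := by
  have absorb (A : Matrix V V R) : A *ᵥ Function.update v l 0 = A.updateCol l 0 *ᵥ v := by
    ext i
    refine sum_congr rfl fun j _ => ?_
    rcases eq_or_ne j l with rfl | hj <;> simp [*]
  rw [adjugate_apply, border_updateRow_some, det_border, absorb, adjugate_apply, borderForm]

theorem borderForm_apply_left (Y : Matrix V V R) {k l : V} (h : k ≠ l) :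
    borderForm Y k l k k = 0 := by
  rw [borderForm, updateCol_ne h, adjugate_apply]
  exact det_zero_of_row_eq h (by simp [updateRow_ne h.symm])

theorem borderForm_apply_right (Y : Matrix V V R) (k l i : V) : borderForm Y k l i l = 0 := by
  simp [borderForm]

theorem borderForm_border (a : R) (u w : V → R) (Y : Matrix V V R) (k l : V) :
    borderForm (border a u w Y) (some k) (some l) none none = Y.adjugate k l := by
  rw [borderForm, updateCol_ne (by simp), border_updateRow_some, adjugate_border_none_none,
    adjugate_apply]

theorem borderForm_submatrix_equiv {W : Type*} [Fintype W] [DecidableEq W] (e : W ≃ V)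
    (Y : Matrix V V R) (k l : W) :
    borderForm (Y.submatrix e e) k l = (borderForm Y (e k) (e l)).submatrix e e := by
  have row : (Y.submatrix e e).updateRow l (Pi.single k 1) =
      (Y.updateRow (e l) (Pi.single (e k) 1)).submatrix e e := by
    ext i j
    simp [updateRow_apply, Pi.single_apply]
  ext i j
  simp [borderForm, row, adjugate_submatrix_equiv_self, updateCol_apply]

theorem adjugate_border_border (a b c d : R) (u w u' w' : V → R) (Z : Matrix V V R) :
    (border a (fun o => o.elim c u) (fun o => o.elim d w) (border b u' w' Z)).adjugate
      (some none) (some none) = (border a u w Z).det := by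
  have swap : border a (fun o => o.elim c u) (fun o => o.elim d w) (border b u' w' Z) =
      (border b (fun o => o.elim d u') (fun o => o.elim c w') (border a u w Z)).submatrix
        (Equiv.swap none (some none)) (Equiv.swap none (some none)) := by
    have fix (i : V) : Equiv.swap none (some none) (some (some i)) = some (some i) :=
      Equiv.swap_apply_of_ne_of_ne (by simp) (by simp)
    ext (_ | _ | i) (_ | _ | j) <;> simp [border, fix]
  rw [swap, adjugate_submatrix_equiv_self, submatrix_apply, Equiv.swap_apply_right,
    adjugate_border_none_none]

end Border

/-- The permutation of unordered pairs induced by a permutation of the elements. -/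
def sym2Equiv {V W : Type*} (e : V ≃ W) : Sym2 V ≃ Sym2 W where
  toFun := Sym2.map e
  invFun := Sym2.map e.symm
  left_inv y := by simp [Sym2.map_map]
  right_inv y := by simp [Sym2.map_map]

/-- The unordered pairs in `Option V` are those containing `none`, indexed by the other element,
and those in `V`. -/
noncomputable def sym2OptionEquiv (V : Type*) : Option V ⊕ Sym2 V ≃ Sym2 (Option V) :=
  Equiv.ofBijective (Sum.elim (fun o => s(none, o)) (Sym2.map some)) <| by
    have ne (o : Option V) (y : Sym2 V) : s(none, o) ≠ Sym2.map some y := by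
      induction y with | _ i j => simp
    constructor
    · rintro (o | y) (o' | y') h
      · exact congr_arg _ (Sym2.congr_right.1 h)
      · exact absurd h (ne o y')
      · exact absurd h.symm (ne o' y)
      · exact congr_arg _ (Sym2.map.injective (Option.some_injective V) h)
    · rintro ⟨_ | i, _ | j⟩
      · exact ⟨.inl none, rfl⟩
      · exact ⟨.inl (some j), rfl⟩
      · exact ⟨.inl (some i), Sym2.eq_swap⟩
      · exact ⟨.inr s(i, j), rfl⟩

namespace SignedLaw

section SymmetricMatrices

variable {K R : Type*} [Fintype K] [CommRing R] (ν : SignedLaw K R)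

/-- The mean of `f` over symmetric matrices whose entries on and above the diagonal are
independent of law `ν`. The entries are indexed by unordered pairs. -/
def symExpect (V : Type*) [Fintype V] [DecidableEq V] (f : Matrix V V R → R) : R :=
  ν.expect fun y : Sym2 V → R => f (of fun i j => y s(i, j))

variable {V W : Type*} [Fintype V] [DecidableEq V] [Fintype W] [DecidableEq W]

theorem symExpect_equiv (e : V ≃ W) (f : Matrix V V R → R) :
    ν.symExpect V f = ν.symExpect W fun Y => f (Y.submatrix e e) :=
  ν.expect_equiv (sym2Equiv e) _

theorem symExpect_option (f : Matrix (Option V) (Option V) R → R) :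
    ν.symExpect (Option V) f = ν.symExpect V fun Y => ν.expect fun v => ν.mean fun a =>
      f (border a v v Y) := by
  have pair_none (o : Option V) : (sym2OptionEquiv V).symm s(none, o) = .inl o := by
    rw [Equiv.symm_apply_eq]; rfl
  have pair_some (i j : V) : (sym2OptionEquiv V).symm s(some i, some j) = .inr s(i, j) := by
    rw [Equiv.symm_apply_eq]; rfl
  rw [symExpect, ν.expect_equiv (sym2OptionEquiv V).symm, expect_sumElim, symExpect]
  congr! 2 with y
  rw [expect_option]
  congr! 5 with v a
  ext (_ | i) (_ | j)
  · simp [border, pair_none]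
  · simp [border, pair_none]
  · simp [border, Sym2.eq_swap (a := some i), pair_none]
  · simp [border, pair_some]

theorem symExpect_congr {f g : Matrix V V R → R} (h : ∀ Y, Y.IsSymm → f Y = g Y) :
    ν.symExpect V f = ν.symExpect V g := by
  simp only [symExpect]
  congr! 2 with y
  exact h _ (by ext i j; simp [Sym2.eq_swap])

theorem symExpect_add (f g : Matrix V V R → R) :
    ν.symExpect V (fun Y => f Y + g Y) = ν.symExpect V f + ν.symExpect V g :=
  ν.expect_add _ _

theorem symExpect_const_mul (c : R) (f : Matrix V V R → R) :
    ν.symExpect V (fun Y => c * f Y) = c * ν.symExpect V f :=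
  ν.expect_const_mul _ _

theorem symExpect_neg (f : Matrix V V R → R) :
    ν.symExpect V (fun Y => -f Y) = -ν.symExpect V f :=
  ν.expect_neg _

theorem symExpect_sum {α : Type*} (s : Finset α) (f : α → Matrix V V R → R) :
    ν.symExpect V (fun Y => ∑ a ∈ s, f a Y) = ∑ a ∈ s, ν.symExpect V (f a) :=
  ν.expect_sum _ _

theorem symExpect_translate (c : R) (f : Matrix V V R → R) :
    (ν.translate c).symExpect V f = ν.symExpect V fun Y => f (Y + of fun _ _ => c) :=
  rfl

theorem IsCentered.symExpect_const {ν : SignedLaw K R} (h : ν.IsCentered) (c : R) :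
    ν.symExpect V (fun _ => c) = c :=
  h.expect_const c

end SymmetricMatrices

section CofactorMoments

variable {K R : Type*} [Fintype K] [CommRing R] (ν : SignedLaw K R)
variable {V W : Type*} [Fintype V] [DecidableEq V] [Fintype W] [DecidableEq W]

variable (V) in
/-- The second moment of the determinant of a symmetric matrix with entries of law `ν`. -/
def detSq : R := ν.symExpect V fun Y => Y.det * Y.det

/-- The mixed moment of the determinant and the `(i, j)` cofactor of a symmetric matrix with
entries of law `ν`. -/
def detCof (i j : V) : R := ν.symExpect V fun Y => Y.det * Y.adjugate i j

/-- The mixed moment of the `(i, j)` and `(k, l)` cofactors of a symmetric matrix with entries of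
law `ν`. -/
def cofCof (i j k l : V) : R := ν.symExpect V fun Y => Y.adjugate i j * Y.adjugate k l

theorem detSq_equiv (e : V ≃ W) : ν.detSq V = ν.detSq W := by
  rw [detSq, symExpect_equiv _ e]
  simp only [det_submatrix_equiv_self, detSq]

theorem detCof_equiv (e : V ≃ W) (i j : V) : ν.detCof (e i) (e j) = ν.detCof i j := by
  rw [eq_comm, detCof, symExpect_equiv _ e]
  simp only [adjugate_submatrix_equiv_self, det_submatrix_equiv_self, submatrix_apply, detCof]

theorem cofCof_equiv (e : V ≃ W) (i j k l : V) :
    ν.cofCof (e i) (e j) (e k) (e l) = ν.cofCof i j k l := by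
  rw [eq_comm, cofCof, symExpect_equiv _ e]
  simp only [adjugate_submatrix_equiv_self, submatrix_apply, cofCof]

theorem sum_cofCof_equiv (e : V ≃ W) (i j : V) :
    ∑ k, ∑ l, ν.cofCof (e i) (e j) k l = ∑ k, ∑ l, ν.cofCof i j k l := by
  rw [← e.sum_comp]
  refine sum_congr rfl fun k _ => ?_
  rw [← e.sum_comp]
  exact sum_congr rfl fun l _ => ν.cofCof_equiv e i j k l

theorem cofCof_comm (i j k l : V) : ν.cofCof i j k l = ν.cofCof k l i j := by
  simp only [cofCof, mul_comm]

theorem cofCof_swap_left (i j k l : V) : ν.cofCof i j k l = ν.cofCof j i k l :=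
  ν.symExpect_congr fun Y hY => by rw [hY.adjugate.apply]

theorem cofCof_swap_right (i j k l : V) : ν.cofCof i j k l = ν.cofCof i j l k :=
  ν.symExpect_congr fun Y hY => by rw [hY.adjugate.apply l k]

namespace IsCentered

variable {ν} (h : ν.IsCentered)
include h

theorem detSq_option :
    ν.detSq (Option V) = ν.moment 2 * ν.detSq V
      + (ν.moment 2 ^ 2 * (∑ i : V, ∑ k, ν.cofCof i i k k + 2 * ∑ i : V, ∑ j, ν.cofCof i j i j)
        + (ν.moment 4 - 3 * ν.moment 2 ^ 2) * ∑ i : V, ν.cofCof i i i i) := by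
  have key (Y : Matrix V V R) (hY : Y.IsSymm) :
      ν.expect (fun v => ν.mean fun a => (border a v v Y).det * (border a v v Y).det) =
      ν.moment 2 * (Y.det * Y.det)
        + (ν.moment 2 ^ 2 * (∑ i, ∑ k, Y.adjugate i i * Y.adjugate k k
          + 2 * ∑ i, ∑ j, Y.adjugate i j * Y.adjugate i j)
        + (ν.moment 4 - 3 * ν.moment 2 ^ 2) * ∑ i, Y.adjugate i i * Y.adjugate i i) := by
    have traces : (Y.adjugate * Y.adjugate).trace = ∑ i, ∑ j, Y.adjugate i j * Y.adjugate i j := by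
      simp [trace, mul_apply, hY.adjugate.apply]
    simp only [det_border, h.mean_affine_mul_affine, expect_add, h.expect_const,
      h.expect_quadraticForm_mul_quadraticForm, hY.adjugate.eq, traces]
    simp only [trace, diag_apply, dotProduct, sum_mul_sum]
    ring
  rw [detSq, symExpect_option, ν.symExpect_congr key]
  simp only [symExpect_add, symExpect_const_mul, symExpect_sum, detSq, cofCof]

theorem detCof_none_none :
    ν.detCof (none : Option V) none = -(ν.moment 2 * ∑ i : V, ν.detCof i i) := by
  simp only [detCof, symExpect_option, det_border, adjugate_border_none_none, mean_mul_const,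
    h.mean_affine, expect_mul_const, expect_neg, h.expect_quadraticForm, ← symExpect_sum,
    ← symExpect_const_mul, ← symExpect_neg]
  congr! 2 with Y
  simp only [trace, diag_apply, ← mul_sum]
  ring

theorem detCof_none_some (k : V) :
    ν.detCof none (some k) = ν.moment 3 * ∑ i, ν.cofCof i i i k := by
  simp only [detCof, symExpect_option, det_border, adjugate_border_none_some, mean_mul_const,
    h.mean_affine, neg_mul_neg, mul_comm (_ ⬝ᵥ _ *ᵥ _), h.expect_dotProduct_mul_quadraticForm,
    symExpect_const_mul]
  simp only [dotProduct, symExpect_sum, col_apply, diag_apply, mul_comm, cofCof]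

theorem cofCof_none_none_none_none :
    ν.cofCof (none : Option V) none none none = ν.detSq V := by
  simp only [cofCof, symExpect_option, adjugate_border_none_none, h.mean_const, h.expect_const,
    detSq]

theorem cofCof_none_none_none_some (k : V) :
    ν.cofCof (none : Option V) none none (some k) = 0 := by
  simp only [cofCof, symExpect_option, adjugate_border_none_none, adjugate_border_none_some,
    h.mean_const, expect_const_mul, expect_neg, h.expect_dotProduct, neg_zero, mul_zero,
    h.symExpect_const]

theorem cofCof_none_some_none_some (j k : V) :
    ν.cofCof none (some j) none (some k) = ν.moment 2 * ∑ i, ν.cofCof i j i k := by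
  simp only [cofCof, symExpect_option, adjugate_border_none_some, neg_mul_neg, h.mean_const,
    h.expect_dotProduct_mul_dotProduct, symExpect_const_mul]
  simp only [dotProduct, symExpect_sum, col_apply]

theorem cofCof_none_some_some_some (j k l : V) :
    ν.cofCof none (some j) (some k) (some l) =
      ν.moment 3 * ∑ i, ν.symExpect V fun Y => Y.adjugate i j * borderForm Y k l i i := by
  simp only [cofCof, symExpect_option, adjugate_border_none_some, adjugate_border_some_some,
    mean_const_mul, h.mean_affine, neg_mul_neg, h.expect_dotProduct_mul_quadraticForm,
    symExpect_const_mul]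
  simp only [dotProduct, symExpect_sum, col_apply, diag_apply]

theorem cofCof_none_none_some_none_some_none :
    ν.cofCof (none : Option (Option V)) none (some none) (some none) =
      ν.moment 2 ^ 2 * ∑ i : V, ∑ k, ν.cofCof i i k k := by
  simp only [cofCof, symExpect_option, expect_option, adjugate_border_none_none,
    adjugate_border_border, mean_const_mul, h.mean_const]
  simp only [det_border, h.mean_affine, expect_neg, mean_mul_const, expect_const_mul,
    expect_mul_const, h.expect_quadraticForm, neg_mul_neg]
  simp only [trace, mul_mul_mul_comm (ν.moment 2), symExpect_const_mul, sum_mul_sum, symExpect_sum,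
    diag_apply, pow_two]

end IsCentered

end CofactorMoments

end SignedLaw

namespace SignedLaw.IsCentered

variable {K R : Type*} [Fintype K] [CommRing R] {ν : SignedLaw K R}

theorem detCof_self (h : ν.IsCentered) {V : Type*} [Fintype V] [DecidableEq V] (i : V) :
    ν.detCof i i = 0 := by
  rw [← ν.detCof_equiv (Equiv.optionSubtypeNe i).symm, Equiv.optionSubtypeNe_symm_self,
    h.detCof_none_none, sum_congr rfl fun j _ => h.detCof_self j, sum_const_zero, mul_zero,
    neg_zero]
termination_by Fintype.card V
decreasing_by exact Fintype.card_subtype_lt (x := i) (by simp)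

theorem cofCof_self_left (h : ν.IsCentered) {V : Type*} [Fintype V] [DecidableEq V] {i j : V}
    (hij : i ≠ j) : ν.cofCof i i i j = 0 := by
  rw [← ν.cofCof_equiv (Equiv.optionSubtypeNe i).symm, Equiv.optionSubtypeNe_symm_self,
    Equiv.optionSubtypeNe_symm_of_ne hij.symm, h.cofCof_none_none_none_some]

theorem cofCof_share (h : ν.IsCentered) {V : Type*} [Fintype V] [DecidableEq V] {i j k : V}
    (hij : i ≠ j) (hik : i ≠ k) (hjk : j ≠ k) : ν.cofCof i j i k = 0 := by
  rw [← ν.cofCof_equiv (Equiv.optionSubtypeNe i).symm, Equiv.optionSubtypeNe_symm_self,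
    Equiv.optionSubtypeNe_symm_of_ne hij.symm, Equiv.optionSubtypeNe_symm_of_ne hik.symm,
    h.cofCof_none_some_none_some, sum_eq_zero fun a _ => ?_, mul_zero]
  have hjk' : (⟨j, hij.symm⟩ : {b // b ≠ i}) ≠ ⟨k, hik.symm⟩ := by simpa
  by_cases haj : a = ⟨j, hij.symm⟩
  · rw [haj, h.cofCof_self_left hjk']
  by_cases hak : a = ⟨k, hik.symm⟩
  · rw [hak, cofCof_comm, h.cofCof_self_left hjk'.symm]
  · exact h.cofCof_share haj hak hjk'
termination_by Fintype.card V
decreasing_by exact Fintype.card_subtype_lt (x := i) (by simp)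

theorem symExpect_adjugate_mul_borderForm (h : ν.IsCentered) {V : Type*} [Fintype V]
    [DecidableEq V] {i j k l : V} (hij : i ≠ j) :
    ν.symExpect V (fun Y => Y.adjugate i j * borderForm Y k l i i) = 0 := by
  rcases eq_or_ne l i with rfl | hli
  · simp only [borderForm_apply_right, mul_zero, h.symExpect_const]
  rcases eq_or_ne k i with rfl | hki
  · simp only [borderForm_apply_left _ hli.symm, mul_zero, h.symExpect_const]
  let e := Equiv.optionSubtypeNe i
  rw [ν.symExpect_equiv e.symm]
  simp only [adjugate_submatrix_equiv_self, borderForm_submatrix_equiv, submatrix_apply, e,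
    Equiv.optionSubtypeNe_symm_self, Equiv.optionSubtypeNe_symm_of_ne hij.symm,
    Equiv.optionSubtypeNe_symm_of_ne hki, Equiv.optionSubtypeNe_symm_of_ne hli]
  simp only [symExpect_option, adjugate_border_none_some, borderForm_border, h.mean_const,
    expect_mul_const, expect_neg, h.expect_dotProduct, neg_zero, zero_mul, h.symExpect_const]

section

variable {V : Type*} [Fintype V] [DecidableEq V] (h : ν.IsCentered)
include h

theorem symExpect_adjugate_none_mul_borderForm (k l : V) :
    ν.symExpect (Option V) (fun Y => Y.adjugate none none *
      borderForm Y (some k) (some l) none none) = ν.detCof k l := by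
  simp only [symExpect_option, adjugate_border_none_none, borderForm_border, h.mean_const,
    h.expect_const, detCof]

theorem cofCof_disjoint (k l : V) :
    ν.cofCof (none : Option (Option V)) (some none) (some (some k)) (some (some l)) =
      ν.moment 3 * ν.detCof k l := by
  rw [h.cofCof_none_some_some_some, Fintype.sum_option, h.symExpect_adjugate_none_mul_borderForm,
    sum_eq_zero fun i _ => h.symExpect_adjugate_mul_borderForm (Option.some_ne_none i), add_zero]

theorem detCof_none_some_none :
    ν.detCof (none : Option (Option V)) (some none) = ν.moment 3 * ν.detSq V := by
  rw [h.detCof_none_some, Fintype.sum_option, h.cofCof_none_none_none_none,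
    sum_eq_zero fun i _ => h.cofCof_self_left (Option.some_ne_none i), add_zero]

theorem sum_cofCof_none_some_none :
    ∑ k, ∑ l, ν.cofCof (none : Option (Option V)) (some none) k l =
      2 * ν.cofCof (none : Option (Option V)) (some none) none (some none)
        + ν.moment 3 * ∑ k : V, ∑ l, ν.detCof k l := by
  have both_left : ν.cofCof (none : Option (Option V)) (some none) none none = 0 := by
    rw [cofCof_comm, h.cofCof_self_left (by simp)]
  have both_right :
      ν.cofCof (none : Option (Option V)) (some none) (some none) (some none) = 0 := by
    rw [cofCof_swap_left, cofCof_comm, h.cofCof_self_left (by simp)]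
  have share_left (k : V) : ν.cofCof none (some none) none (some (some k)) = 0 :=
    h.cofCof_share (by simp) (by simp) (by simp)
  have share_right (k : V) : ν.cofCof none (some none) (some none) (some (some k)) = 0 := by
    rw [cofCof_swap_left, h.cofCof_share (by simp) (by simp) (by simp)]
  simp only [Fintype.sum_option, both_left, both_right, share_left, share_right,
    ν.cofCof_swap_right _ _ _ none, ν.cofCof_swap_right _ _ (some (some _)) (some none),
    h.cofCof_disjoint, mul_sum, sum_const_zero, zero_add, add_zero]
  ring

theorem cofCof_self_disjoint {i k l : V} (hik : i ≠ k) (hil : i ≠ l) (hkl : k ≠ l) :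
    ν.cofCof i i k l = 0 := by
  let l' : {b // b ≠ k} := ⟨l, hkl.symm⟩
  let i' : {b // b ≠ l'} := ⟨⟨i, hik⟩, by simpa [l'] using hil⟩
  let e := (Equiv.optionSubtypeNe l').optionCongr.trans (Equiv.optionSubtypeNe k)
  have key := ν.cofCof_equiv e none (some none) (some (some i')) (some (some i'))
  rw [h.cofCof_disjoint, h.detCof_self, mul_zero] at key
  rw [cofCof_comm]
  simpa [e, i', l'] using key

theorem sum_cofCof_none_none :
    ∑ k, ∑ l, ν.cofCof (none : Option V) none k l =
      ν.detSq V + ∑ k : V, ν.cofCof none none (some k) (some k) := by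
  simp only [Fintype.sum_option, h.cofCof_none_none_none_none, h.cofCof_none_none_none_some,
    ν.cofCof_swap_right _ _ (some _) none, sum_const_zero, add_zero, zero_add]
  congr! 2 with k
  exact Fintype.sum_eq_single k fun l hl =>
    h.cofCof_self_disjoint (by simp) (by simp) (by simpa using hl.symm)

end

end SignedLaw.IsCentered

section Shift

variable {R : Type*} [CommSemiring R]

/-- The sequence `n u (n - 1)`. Its exponential generating function is that of `u` times the
variable, and `egfShift c n` is the sum over the elements of an `n`-element set of a quantity whose
value `c (n - 1)` depends only on the number of remaining elements. -/
def egfShift (u : ℕ → R) (n : ℕ) : R := n * u (n - 1)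

theorem egfShift_add (u v : ℕ → R) :
    egfShift (fun n => u n + v n) = fun n => egfShift u n + egfShift v n :=
  funext fun _ => mul_add _ _ _

theorem egfShift_const_mul (c : R) (u : ℕ → R) :
    egfShift (fun n => c * u n) = fun n => c * egfShift u n :=
  funext fun _ => mul_left_comm _ _ _

variable {W : Type*} [Fintype W]

theorem sum_eq_egfShift {f : W → R} {c : ℕ → R}
    (h : ∀ m (e : Option (Fin m) ≃ W), f (e none) = c m) :
    ∑ i, f i = egfShift c (Fintype.card W) := by
  classical
  have value (i : W) : f i = c (Fintype.card W - 1) := by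
    have others : Fintype.card {b // b ≠ i} = Fintype.card W - 1 := by simp
    exact h _ ((Fintype.equivFinOfCardEq others).symm.optionCongr.trans
      (Equiv.optionSubtypeNe i))
  rw [sum_congr rfl fun i _ => value i, sum_const, card_univ, nsmul_eq_mul, egfShift]

theorem sum_sum_eq_egfShift {F : W → W → R} {d c : ℕ → R}
    (hd : ∀ m (e : Option (Fin m) ≃ W), F (e none) (e none) = d m)
    (hc : ∀ m (e : Option (Option (Fin m)) ≃ W), F (e none) (e (some none)) = c m) :
    ∑ i, ∑ j, F i j =
      egfShift d (Fintype.card W) + egfShift (egfShift c) (Fintype.card W) := by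
  rw [← congr_fun (egfShift_add d (egfShift c))]
  refine sum_eq_egfShift fun m e => ?_
  rw [← e.sum_comp, Fintype.sum_option, hd,
    sum_eq_egfShift (f := fun i => F (e none) (e (some i))) (c := c)
      fun m' e' => hc m' (e'.optionCongr.trans e), Fintype.card_fin]

end Shift

/-- The recursion for the second moment `d n` of the determinant of a centred symmetric matrix of
size `n`, coupled to the second moment `b n` of an off-diagonal cofactor and to the mixed moment
`c n` of two diagonal cofactors in size `n + 2`. -/
structure DetMomentRecursion {R : Type*} [CommRing R] (μ₂ μ₄ : R) (d b c : ℕ → R) : Prop where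
  det_zero : d 0 = 1
  det_succ : ∀ n, d (n + 1) = μ₂ * d n + μ₄ * egfShift d n
    + μ₂ ^ 2 * (egfShift (egfShift c) n + 2 * egfShift (egfShift b) n)
  offDiag : ∀ n, b n = μ₂ * (d n + egfShift b n)
  diag : ∀ n, c n = μ₂ ^ 2 * (egfShift d n + egfShift (egfShift c) n)

namespace SignedLaw

variable {K R : Type*} [Fintype K] [CommRing R] (ν : SignedLaw K R)

/-- The second moment of an off-diagonal cofactor of a symmetric matrix of size `n + 2`. -/
def offDiagCofSq (n : ℕ) : R :=
  ν.cofCof (none : Option (Option (Fin n))) (some none) none (some none)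

/-- The mixed moment of two diagonal cofactors of a symmetric matrix of size `n + 2`. -/
def diagCofProd (n : ℕ) : R :=
  ν.cofCof (none : Option (Option (Fin n))) none (some none) (some none)

namespace IsCentered

variable {ν} (h : ν.IsCentered)
include h

section Sums

variable {V : Type*} [Fintype V] [DecidableEq V]

theorem sum_cofCof_self :
    ∑ i : V, ν.cofCof i i i i = egfShift (fun n => ν.detSq (Fin n)) (Fintype.card V) :=
  sum_eq_egfShift fun _ e => by rw [cofCof_equiv, h.cofCof_none_none_none_none]

theorem sum_cofCof_diag :
    ∑ i : V, ∑ k, ν.cofCof i i k k = egfShift (fun n => ν.detSq (Fin n)) (Fintype.card V)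
      + egfShift (egfShift ν.diagCofProd) (Fintype.card V) :=
  sum_sum_eq_egfShift (fun _ e => by rw [cofCof_equiv, h.cofCof_none_none_none_none])
    fun _ e => ν.cofCof_equiv e _ _ _ _

theorem sum_cofCof_sq :
    ∑ i : V, ∑ j, ν.cofCof i j i j = egfShift (fun n => ν.detSq (Fin n)) (Fintype.card V)
      + egfShift (egfShift ν.offDiagCofSq) (Fintype.card V) :=
  sum_sum_eq_egfShift (fun _ e => by rw [cofCof_equiv, h.cofCof_none_none_none_none])
    fun _ e => ν.cofCof_equiv e _ _ _ _

theorem sum_detCof :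
    ∑ i : V, ∑ j, ν.detCof i j =
      ν.moment 3 * egfShift (egfShift fun n => ν.detSq (Fin n)) (Fintype.card V) := by
  rw [sum_sum_eq_egfShift (d := fun _ => 0) (c := fun n => ν.moment 3 * ν.detSq (Fin n))
    (fun _ e => h.detCof_self _) fun _ e => by rw [detCof_equiv, h.detCof_none_some_none]]
  simp only [egfShift, mul_zero, zero_add]
  ring

theorem sum_cofCof :
    ∑ i : V, ∑ j, ∑ k, ∑ l, ν.cofCof i j k l =
      egfShift (fun n => ν.detSq (Fin n)) (Fintype.card V)
        + egfShift (egfShift ν.diagCofProd) (Fintype.card V)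
        + 2 * egfShift (egfShift ν.offDiagCofSq) (Fintype.card V)
        + ν.moment 3 ^ 2 * egfShift (egfShift (egfShift (egfShift fun n => ν.detSq (Fin n))))
          (Fintype.card V) := by
  have diagonal m (e : Option (Fin m) ≃ V) : ∑ k, ∑ l, ν.cofCof (e none) (e none) k l =
      ν.detSq (Fin m) + egfShift ν.diagCofProd m := by
    rw [sum_cofCof_equiv, h.sum_cofCof_none_none, sum_eq_egfShift (c := ν.diagCofProd)
      fun _ e => ν.cofCof_equiv e.optionCongr none none (some none) (some none), Fintype.card_fin]
  have offDiagonal m (e : Option (Option (Fin m)) ≃ V) :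
      ∑ k, ∑ l, ν.cofCof (e none) (e (some none)) k l = 2 * ν.offDiagCofSq m
        + ν.moment 3 ^ 2 * egfShift (egfShift fun n => ν.detSq (Fin n)) m := by
    rw [sum_cofCof_equiv, h.sum_cofCof_none_some_none, h.sum_detCof, Fintype.card_fin, pow_two,
      mul_assoc, offDiagCofSq]
  rw [sum_sum_eq_egfShift diagonal offDiagonal]
  simp only [egfShift_add, egfShift_const_mul]
  ring

end Sums

theorem detMomentRecursion : DetMomentRecursion (ν.moment 2) (ν.moment 4)
    (fun n => ν.detSq (Fin n)) ν.offDiagCofSq ν.diagCofProd where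
  det_zero := by
    simp only [detSq, det_fin_zero, mul_one, h.symExpect_const]
  det_succ n := by
    rw [ν.detSq_equiv (finSuccEquiv n), h.detSq_option, h.sum_cofCof_self, h.sum_cofCof_diag,
      h.sum_cofCof_sq, Fintype.card_fin]
    ring
  offDiag n := by
    rw [offDiagCofSq, h.cofCof_none_some_none_some, Fintype.sum_option,
      h.cofCof_none_none_none_none,
      sum_eq_egfShift (c := ν.offDiagCofSq) fun m e => ?_, Fintype.card_fin]
    rw [cofCof_swap_left, cofCof_swap_right]
    exact ν.cofCof_equiv e.optionCongr none (some none) none (some none)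
  diag n := by
    rw [diagCofProd, h.cofCof_none_none_some_none_some_none, h.sum_cofCof_diag, Fintype.card_fin]

theorem detSq_translate (m : R) (n : ℕ) :
    (ν.translate m).detSq (Fin n) = ν.detSq (Fin n)
      + 2 * m * ν.moment 3 * egfShift (egfShift fun n => ν.detSq (Fin n)) n
      + m ^ 2 * (egfShift (fun n => ν.detSq (Fin n)) n + egfShift (egfShift ν.diagCofProd) n
        + 2 * egfShift (egfShift ν.offDiagCofSq) n
        + ν.moment 3 ^ 2
          * egfShift (egfShift (egfShift (egfShift fun n => ν.detSq (Fin n)))) n) := by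
  have expand (Y : Matrix (Fin n) (Fin n) R) :
      (Y + of fun _ _ => m).det * (Y + of fun _ _ => m).det = Y.det * Y.det
        + 2 * m * ∑ i, ∑ j, Y.det * Y.adjugate i j
        + m ^ 2 * ∑ i, ∑ j, ∑ k, ∑ l, Y.adjugate i j * Y.adjugate k l := by
    simp only [det_add_const, ← mul_sum, ← sum_mul]
    ring
  rw [detSq, symExpect_translate]
  simp only [expand, symExpect_add, symExpect_const_mul, symExpect_sum]
  have detCof_total := h.sum_detCof (V := Fin n)
  have cofCof_total := h.sum_cofCof (V := Fin n)
  simp only [detCof, cofCof, Fintype.card_fin] at detCof_total cofCof_total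
  rw [detCof_total, cofCof_total, detSq]
  ring

end IsCentered

end SignedLaw

theorem egfShift_congr {R : Type*} [CommSemiring R] {u v : ℕ → R} {n : ℕ}
    (h : ∀ k < n, u k = v k) : egfShift u n = egfShift v n := by
  cases n with
  | zero => simp [egfShift]
  | succ n => simp [egfShift, h n n.lt_succ_self]

namespace DetMomentRecursion

variable {R S : Type*} [CommRing R] [CommRing S] {μ₂ μ₄ : R} {d b c d' b' c' : ℕ → R}

theorem eq_of_det_eq (H : DetMomentRecursion μ₂ μ₄ d b c) (H' : DetMomentRecursion μ₂ μ₄ d' b' c')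
    (n : ℕ) (h : ∀ k ≤ n, d k = d' k) : b n = b' n ∧ c n = c' n := by
  induction n using Nat.strong_induction_on with
  | _ n ih =>
    have below k (hk : k < n) := ih k hk fun j hj => h j (hj.trans hk.le)
    rw [H.offDiag, H'.offDiag, H.diag, H'.diag, h n le_rfl,
      egfShift_congr fun k hk => (below k hk).1, egfShift_congr fun k hk => h k hk.le,
      egfShift_congr fun k hk => egfShift_congr fun j hj => (below j (hj.trans hk)).2]
    exact ⟨rfl, rfl⟩

theorem det_unique (H : DetMomentRecursion μ₂ μ₄ d b c) (H' : DetMomentRecursion μ₂ μ₄ d' b' c')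
    (n : ℕ) : d n = d' n := by
  induction n using Nat.strong_induction_on with
  | _ n ih =>
    cases n with
    | zero => rw [H.det_zero, H'.det_zero]
    | succ n =>
      have cofactors k (hk : k < n) :=
        H.eq_of_det_eq H' k fun j hj => ih j (hj.trans_lt (hk.trans n.lt_succ_self))
      rw [H.det_succ, H'.det_succ, ih n n.lt_succ_self,
        egfShift_congr fun k hk => ih k (hk.trans n.lt_succ_self),
        egfShift_congr fun k hk => egfShift_congr fun j hj => (cofactors j (hj.trans hk)).1,
        egfShift_congr fun k hk => egfShift_congr fun j hj => (cofactors j (hj.trans hk)).2]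

theorem map (H : DetMomentRecursion μ₂ μ₄ d b c) (f : R →+* S) :
    DetMomentRecursion (f μ₂) (f μ₄) (fun n => f (d n)) (fun n => f (b n)) fun n => f (c n) where
  det_zero := by rw [H.det_zero, map_one]
  det_succ n := by simp only [H.det_succ, egfShift, map_add, map_mul, map_pow, map_natCast,
    map_ofNat]
  offDiag n := by simp only [H.offDiag n, egfShift, map_add, map_mul, map_natCast]
  diag n := by simp only [H.diag n, egfShift, map_add, map_mul, map_pow, map_natCast]

end DetMomentRecursion

section Holomorphic

open Filter Topology Complex

theorem iteratedDeriv_id_mul {𝕜 : Type*} [NontriviallyNormedField 𝕜] {f : 𝕜 → 𝕜} {n : ℕ}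
    (hf : ContDiffAt 𝕜 n f 0) :
    iteratedDeriv n (fun z => z * f z) 0 = egfShift (fun k => iteratedDeriv k f 0) n := by
  rw [iteratedDeriv_fun_mul contDiffAt_fun_id hf]
  simp only [iteratedDeriv_fun_id_zero, mul_ite, mul_one, mul_zero, ite_mul, zero_mul, sum_ite_eq']
  cases n <;> simp [egfShift]

variable {μ₂ μ₄ z : ℂ}

/-- The exponential generating function of the second moments of determinants of centred
symmetric matrices. Principal logarithms replace the square root and the denominator, which makes
the differential equation a computation in the exponent. -/
noncomputable def detEgf (μ₂ μ₄ z : ℂ) : ℂ :=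
  exp ((μ₄ - 3 * μ₂ ^ 2) * z ^ 2 / 2 - μ₂ * z
    - 2 * log (1 - μ₂ * z) - log (1 - (μ₂ * z) ^ 2) / 2)

/-- The exponential generating function of the second moments of off-diagonal cofactors. -/
noncomputable def offDiagEgf (μ₂ μ₄ z : ℂ) : ℂ := μ₂ / (1 - μ₂ * z) * detEgf μ₂ μ₄ z

/-- The exponential generating function of the mixed moments of two diagonal cofactors. -/
noncomputable def diagEgf (μ₂ μ₄ z : ℂ) : ℂ :=
  μ₂ ^ 2 * z / (1 - (μ₂ * z) ^ 2) * detEgf μ₂ μ₄ z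

theorem one_sub_mem_slitPlane (hz : ‖z‖ < 1) : 1 - z ∈ slitPlane := by
  simpa [sub_eq_add_neg] using mem_slitPlane_of_norm_lt_one (z := -z) (by simpa using hz)

theorem norm_sq_lt_one (hz : ‖z‖ < 1) : ‖z ^ 2‖ < 1 := by
  rw [norm_pow]
  exact pow_lt_one₀ (norm_nonneg z) hz two_ne_zero

theorem offDiagEgf_eq (hz : ‖μ₂ * z‖ < 1) :
    offDiagEgf μ₂ μ₄ z = μ₂ * (detEgf μ₂ μ₄ z + z * offDiagEgf μ₂ μ₄ z) := by
  have := slitPlane_ne_zero (one_sub_mem_slitPlane hz)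
  rw [offDiagEgf]
  field_simp
  ring

theorem diagEgf_eq (hz : ‖μ₂ * z‖ < 1) :
    diagEgf μ₂ μ₄ z = μ₂ ^ 2 * (z * detEgf μ₂ μ₄ z + z * (z * diagEgf μ₂ μ₄ z)) := by
  have ne := slitPlane_ne_zero (one_sub_mem_slitPlane (norm_sq_lt_one hz))
  rw [mul_pow] at ne
  rw [diagEgf, mul_pow]
  field_simp
  ring

theorem hasDerivAt_detEgf (hz : ‖μ₂ * z‖ < 1) :
    HasDerivAt (detEgf μ₂ μ₄) (μ₂ * detEgf μ₂ μ₄ z + μ₄ * (z * detEgf μ₂ μ₄ z)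
      + μ₂ ^ 2 * (z * (z * diagEgf μ₂ μ₄ z) + 2 * (z * (z * offDiagEgf μ₂ μ₄ z)))) z := by
  have lin : HasDerivAt (fun z => μ₂ * z) μ₂ z := by simpa using (hasDerivAt_id z).const_mul μ₂
  have logLin := (lin.const_sub 1).clog (one_sub_mem_slitPlane hz)
  have logSq := ((lin.fun_pow 2).const_sub 1).clog (one_sub_mem_slitPlane (norm_sq_lt_one hz))
  have quad := ((hasDerivAt_pow 2 z).const_mul (μ₄ - 3 * μ₂ ^ 2)).div_const 2
  refine (((quad.sub lin).sub (logLin.const_mul 2)).sub (logSq.div_const 2)).cexp.congr_deriv ?_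
  have ne := slitPlane_ne_zero (one_sub_mem_slitPlane hz)
  have ne' := slitPlane_ne_zero (one_sub_mem_slitPlane (norm_sq_lt_one hz))
  change detEgf μ₂ μ₄ z * _ = _
  rw [diagEgf, offDiagEgf]
  rw [mul_pow] at ne' ⊢
  field_simp
  ring

theorem differentiableOn_detEgf (μ₂ μ₄ : ℂ) :
    DifferentiableOn ℂ (detEgf μ₂ μ₄) {z | ‖μ₂ * z‖ < 1} :=
  fun _ hz => (hasDerivAt_detEgf hz).differentiableAt.differentiableWithinAt

theorem differentiableOn_offDiagEgf (μ₂ μ₄ : ℂ) :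
    DifferentiableOn ℂ (offDiagEgf μ₂ μ₄) {z | ‖μ₂ * z‖ < 1} :=
  ((differentiableOn_const _).fun_div (by fun_prop)
    fun _ hz => slitPlane_ne_zero (one_sub_mem_slitPlane hz)).fun_mul
      (differentiableOn_detEgf μ₂ μ₄)

theorem differentiableOn_diagEgf (μ₂ μ₄ : ℂ) :
    DifferentiableOn ℂ (diagEgf μ₂ μ₄) {z | ‖μ₂ * z‖ < 1} :=
  ((differentiableOn_id.const_mul _).fun_div (by fun_prop)
    fun _ hz => slitPlane_ne_zero (one_sub_mem_slitPlane (norm_sq_lt_one hz))).fun_mul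
      (differentiableOn_detEgf μ₂ μ₄)

theorem eventually_norm_mul_lt_one (μ₂ : ℂ) : ∀ᶠ z in 𝓝 0, ‖μ₂ * z‖ < 1 :=
  ContinuousAt.eventually_lt (by fun_prop) continuousAt_const (by simp)

theorem detMomentRecursion_iteratedDeriv (μ₂ μ₄ : ℂ) : DetMomentRecursion μ₂ μ₄
    (fun n => iteratedDeriv n (detEgf μ₂ μ₄) 0) (fun n => iteratedDeriv n (offDiagEgf μ₂ μ₄) 0)
    (fun n => iteratedDeriv n (diagEgf μ₂ μ₄) 0) := by
  have near := eventually_norm_mul_lt_one μ₂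
  have smooth {f : ℂ → ℂ} (hf : DifferentiableOn ℂ f {z | ‖μ₂ * z‖ < 1}) (n : ℕ) :
      ContDiffAt ℂ n f 0 := (hf.analyticAt near).contDiffAt
  have smoothDet := smooth (differentiableOn_detEgf μ₂ μ₄)
  have smoothOffDiag := smooth (differentiableOn_offDiagEgf μ₂ μ₄)
  have smoothDiag := smooth (differentiableOn_diagEgf μ₂ μ₄)
  constructor
  · simp [detEgf]
  · intro n
    rw [iteratedDeriv_succ', EventuallyEq.iteratedDeriv_eq n
      (near.mono fun z hz => (hasDerivAt_detEgf (μ₄ := μ₄) hz).deriv)]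
    simp (discharger := fun_prop) only [iteratedDeriv_fun_add, iteratedDeriv_const_mul,
      iteratedDeriv_id_mul]
  · intro n
    rw [EventuallyEq.iteratedDeriv_eq n (near.mono fun z hz => offDiagEgf_eq hz)]
    simp (discharger := fun_prop) only [iteratedDeriv_fun_add, iteratedDeriv_const_mul,
      iteratedDeriv_id_mul]
  · intro n
    rw [EventuallyEq.iteratedDeriv_eq n (near.mono fun z hz => diagEgf_eq hz)]
    simp (discharger := fun_prop) only [iteratedDeriv_fun_add, iteratedDeriv_const_mul,
      iteratedDeriv_id_mul]

theorem hasSum_iteratedDeriv_mul_pow_div_factorial {f : ℂ → ℂ}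
    (hf : DifferentiableOn ℂ f {z | ‖μ₂ * z‖ < 1}) (hz : ‖μ₂ * z‖ < 1) :
    HasSum (fun n : ℕ => iteratedDeriv n f 0 * (z ^ n / n.factorial)) (f z) := by
  have radius : ∀ᶠ r in 𝓝[>] ‖z‖, ‖μ₂‖ * r < 1 := by
    refine eventually_nhdsWithin_of_eventually_nhds
      (ContinuousAt.eventually_lt (by fun_prop) continuousAt_const ?_)
    rwa [← norm_mul]
  obtain ⟨r, hr, zr⟩ := (radius.and self_mem_nhdsWithin).exists
  have onBall : DifferentiableOn ℂ f (Metric.ball 0 r) := hf.mono fun w hw => by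
    refine (norm_mul_le _ _).trans_lt ?_
    exact (mul_le_mul_of_nonneg_left (mem_ball_zero_iff.1 hw).le (norm_nonneg _)).trans_lt hr
  convert! Complex.hasSum_taylorSeries_on_ball onBall (mem_ball_zero_iff.2 zr) using 2 with n
  rw [sub_zero, smul_smul, smul_eq_mul]
  ring

end Holomorphic

section GeneratingFunctions

/-- The exponential generating function of `u` converges at `t`, with sum `s`. -/
def HasEgf {𝕜 : Type*} [Field 𝕜] [TopologicalSpace 𝕜] (u : ℕ → 𝕜) (t s : 𝕜) : Prop :=
  HasSum (fun n => u n * (t ^ n / n.factorial)) s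

namespace HasEgf

variable {𝕜 : Type*} [Field 𝕜] [TopologicalSpace 𝕜] [IsTopologicalRing 𝕜] {u v : ℕ → 𝕜}
  {t s s' : 𝕜}

theorem add (hu : HasEgf u t s) (hv : HasEgf v t s') :
    HasEgf (fun n => u n + v n) t (s + s') := by
  simpa only [HasEgf, add_mul] using HasSum.add hu hv

theorem const_mul (c : 𝕜) (hu : HasEgf u t s) : HasEgf (fun n => c * u n) t (c * s) := by
  simpa only [HasEgf, mul_assoc] using HasSum.mul_left c hu

theorem shift [CharZero 𝕜] (hu : HasEgf u t s) : HasEgf (egfShift u) t (t * s) := by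
  rw [HasEgf, ← hasSum_nat_add_iff' 1]
  convert! HasSum.mul_left t hu using 1
  · ext n
    have := n.cast_add_one_ne_zero (R := 𝕜)
    rw [egfShift, Nat.add_sub_cancel, Nat.factorial_succ]
    push_cast
    field_simp
    ring
  · simp [egfShift]

end HasEgf

end GeneratingFunctions

section Real

variable {μ₂ μ₄ t : ℝ} {d b c : ℕ → ℝ}

theorem detEgf_ofReal (ht : |μ₂ * t| < 1) : detEgf μ₂ μ₄ t =
    (Real.exp ((μ₄ - 3 * μ₂ ^ 2) * t ^ 2 / 2 - μ₂ * t)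
      / ((1 - μ₂ * t) ^ 2 * √(1 - μ₂ ^ 2 * t ^ 2)) : ℝ) := by
  have pos : 0 < 1 - μ₂ * t := sub_pos.2 (abs_lt.1 ht).2
  have sq_pos : 0 < 1 - μ₂ ^ 2 * t ^ 2 := by
    rw [← mul_pow]
    exact sub_pos.2 ((sq_lt_one_iff_abs_lt_one _).2 ht)
  rw [← Real.exp_log pos, ← Real.exp_log (Real.sqrt_pos.2 sq_pos), Real.log_sqrt sq_pos.le,
    ← Real.exp_nat_mul, ← Real.exp_add, ← Real.exp_sub, detEgf]
  push_cast [Complex.ofReal_log pos.le, Complex.ofReal_log sq_pos.le]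
  ring_nf

theorem hasEgf_of_iteratedDeriv {f : ℂ → ℂ} {u : ℕ → ℝ} {s : ℝ}
    (hf : DifferentiableOn ℂ f {z | ‖(μ₂ : ℂ) * z‖ < 1}) (ht : |μ₂ * t| < 1)
    (hu : ∀ n, (u n : ℂ) = iteratedDeriv n f 0) (hs : f t = s) : HasEgf u t s := by
  rw [HasEgf, ← Complex.hasSum_ofReal]
  have norm_lt : ‖(μ₂ * t : ℂ)‖ < 1 := by rwa [← Complex.ofReal_mul, Complex.norm_real]
  simpa [hu, hs] using hasSum_iteratedDeriv_mul_pow_div_factorial hf norm_lt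

theorem DetMomentRecursion.hasEgf (H : DetMomentRecursion μ₂ μ₄ d b c) (ht : |μ₂ * t| < 1) {s : ℝ}
    (hs : s = Real.exp ((μ₄ - 3 * μ₂ ^ 2) * t ^ 2 / 2 - μ₂ * t)
      / ((1 - μ₂ * t) ^ 2 * √(1 - μ₂ ^ 2 * t ^ 2))) :
    HasEgf d t s ∧ HasEgf b t (μ₂ / (1 - μ₂ * t) * s) ∧
      HasEgf c t (μ₂ ^ 2 * t / (1 - μ₂ ^ 2 * t ^ 2) * s) := by
  have taylor := detMomentRecursion_iteratedDeriv (μ₂ : ℂ) μ₄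
  have HC := H.map Complex.ofRealHom
  have det := HC.det_unique taylor
  have cofactors n := HC.eq_of_det_eq taylor n fun k _ => det k
  have value : detEgf μ₂ μ₄ t = s := by rw [detEgf_ofReal ht, hs]
  exact ⟨hasEgf_of_iteratedDeriv (differentiableOn_detEgf _ _) ht det value,
    hasEgf_of_iteratedDeriv (differentiableOn_offDiagEgf _ _) ht (fun n => (cofactors n).1)
      (by rw [offDiagEgf, value]; push_cast; rfl),
    hasEgf_of_iteratedDeriv (differentiableOn_diagEgf _ _) ht (fun n => (cofactors n).2)
      (by rw [diagEgf, value, mul_pow]; push_cast; rfl)⟩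

end Real

theorem SignedLaw.IsCentered.hasEgf_detSq_translate {K : Type*} [Fintype K] {ν : SignedLaw K ℝ}
    {μ₂ μ₃ μ₄ t : ℝ} (h : ν.IsCentered) (h₂ : ν.moment 2 = μ₂) (h₃ : ν.moment 3 = μ₃)
    (h₄ : ν.moment 4 = μ₄) (m : ℝ) (ht : |μ₂ * t| < 1) :
    HasEgf (fun n => (ν.translate m).detSq (Fin n)) t
      ((1 + 2 * m * μ₃ * t ^ 2 + m ^ 2 * (μ₃ ^ 2 * t ^ 4 + t / (1 - μ₂ ^ 2 * t ^ 2)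
          + 2 * μ₂ * t ^ 2 / (1 - μ₂ * t)))
        * (Real.exp ((μ₄ - 3 * μ₂ ^ 2) * t ^ 2 / 2 - μ₂ * t)
            / ((1 - μ₂ * t) ^ 2 * √(1 - μ₂ ^ 2 * t ^ 2)))) := by
  subst h₂ h₃ h₄
  obtain ⟨det, offDiag, diag⟩ := h.detMomentRecursion.hasEgf ht rfl
  have sq_ne : 1 - ν.moment 2 ^ 2 * t ^ 2 ≠ 0 := by
    rw [← mul_pow]
    exact (sub_pos.2 ((sq_lt_one_iff_abs_lt_one _).2 ht)).ne'
  simp only [h.detSq_translate]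
  convert! (det.add (det.shift.shift.const_mul (2 * m * ν.moment 3))).add
    ((((det.shift.add diag.shift.shift).add (offDiag.shift.shift.const_mul 2)).add
      (det.shift.shift.shift.shift.const_mul (ν.moment 3 ^ 2))).const_mul (m ^ 2)) using 1
  have diag_coeff : t / (1 - ν.moment 2 ^ 2 * t ^ 2) =
      t + t * (t * (ν.moment 2 ^ 2 * t / (1 - ν.moment 2 ^ 2 * t ^ 2))) := by
    linear_combination t * mul_inv_cancel₀ sq_ne
  rw [diag_coeff]
  ring

section Quadrature

variable {K : Type*} [Fintype K] {ρ : Measure ℝ} {N : ℕ} {ν : SignedLaw K ℝ}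

/-- The signed law `ν` integrates polynomials of degree at most `N` as the measure `ρ` does. -/
def IsQuadrature (ρ : Measure ℝ) (N : ℕ) (ν : SignedLaw K ℝ) : Prop :=
  ∀ q : Polynomial ℝ, q.natDegree ≤ N → ∫ x, q.eval x ∂ρ = ν.mean fun x => q.eval x

theorem IsQuadrature.integral_pow (h : IsQuadrature ρ N ν) {k : ℕ} (hk : k ≤ N) :
    ∫ x, x ^ k ∂ρ = ν.moment k := by
  simpa using! h (Polynomial.X ^ k) (by simpa using hk)

theorem IsQuadrature.moment_translate_neg_mean (h : IsQuadrature ρ N ν) {k : ℕ} (hk : k ≤ N) :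
    (ν.translate (-∫ x, x ∂ρ)).moment k = centralMoment id k ρ := by
  have key := h ((Polynomial.X - Polynomial.C (∫ x, x ∂ρ)) ^ k) (by simpa using hk)
  simpa [centralMoment, SignedLaw.moment, SignedLaw.mean, SignedLaw.translate, sub_eq_add_neg]
    using key.symm

theorem IsQuadrature.isCentered_translate_neg_mean [IsProbabilityMeasure ρ]
    (h : IsQuadrature ρ N ν) (hN : 1 ≤ N) : (ν.translate (-∫ x, x ∂ρ)).IsCentered where
  moment_zero := by simp [h.moment_translate_neg_mean N.zero_le, centralMoment]
  moment_one := by rw [h.moment_translate_neg_mean hN, centralMoment_one]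

variable [IsFiniteMeasure ρ]

theorem integrable_pow_of_memLp (hρ : MemLp (id : ℝ → ℝ) N ρ) {k : ℕ} (hk : k ≤ N) :
    Integrable (fun x => x ^ k) ρ := by
  rcases k.eq_zero_or_pos with rfl | k_pos
  · simp
  have memLp_k : MemLp (id : ℝ → ℝ) k ρ := hρ.mono_exponent (by exact_mod_cast hk)
  exact (integrable_norm_iff (by fun_prop)).1 (by simpa using memLp_k.integrable_norm_pow k_pos.ne')

theorem integrable_eval_of_memLp (hρ : MemLp (id : ℝ → ℝ) N ρ) {q : Polynomial ℝ}
    (hq : q.natDegree ≤ N) : Integrable (fun x => q.eval x) ρ := by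
  simp only [Polynomial.eval_eq_sum_range]
  exact integrable_finsetSum _ fun k hk =>
    (integrable_pow_of_memLp hρ ((mem_range_succ_iff.1 hk).trans hq)).const_mul _

theorem exists_isQuadrature (hρ : MemLp (id : ℝ → ℝ) N ρ) :
    ∃ ν : SignedLaw (Fin (N + 1)) ℝ, IsQuadrature ρ N ν := by
  let node (i : Fin (N + 1)) : ℝ := i
  have inj : Set.InjOn node (univ : Finset (Fin (N + 1))) := fun i _ j _ h => by
    simpa [node, Fin.ext_iff] using h
  refine ⟨⟨fun i => ∫ x, (Lagrange.basis univ node i).eval x ∂ρ, node⟩, fun q hq => ?_⟩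
  have degree_lt : q.degree < #(univ : Finset (Fin (N + 1))) := by
    rw [card_univ, Fintype.card_fin]
    exact Polynomial.degree_le_natDegree.trans_lt (by exact_mod_cast Nat.lt_succ_of_le hq)
  have interpolate (x : ℝ) :
      q.eval x = ∑ i, (Lagrange.basis univ node i).eval x * q.eval (node i) := by
    conv_lhs => rw [Lagrange.eq_interpolate inj degree_lt, Lagrange.interpolate_apply]
    simp [Polynomial.eval_finsetSum, mul_comm]
  rw [integral_congr_ae (ae_of_all _ interpolate), integral_finsetSum]
  · simp only [integral_mul_const, SignedLaw.mean]
  · refine fun i _ => (integrable_eval_of_memLp hρ ?_).mul_const _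
    rw [Lagrange.natDegree_basis inj (mem_univ i)]
    simp

end Quadrature

section MvPolynomial

variable {ι K : Type*} [Fintype ι] [Fintype K] {ρ : Measure ℝ} {N : ℕ}
  {p : MvPolynomial ι ℝ}

theorem integrable_mvPolynomial_eval [IsFiniteMeasure ρ] (hρ : MemLp (id : ℝ → ℝ) N ρ)
    (hp : ∀ i, p.degreeOf i ≤ N) : Integrable (fun x => p.eval x) (Measure.pi fun _ => ρ) := by
  simp only [MvPolynomial.eval_eq']
  exact integrable_finsetSum _ fun d hd => (Integrable.fintype_prod (f := fun i x => x ^ d i)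
    fun i => integrable_pow_of_memLp hρ (MvPolynomial.degreeOf_le_iff.1 (hp i) d hd)).const_mul _

theorem IsQuadrature.integral_mvPolynomial_eval [IsFiniteMeasure ρ] [DecidableEq ι]
    {ν : SignedLaw K ℝ} (h : IsQuadrature ρ N ν) (hρ : MemLp (id : ℝ → ℝ) N ρ)
    (hp : ∀ i, p.degreeOf i ≤ N) :
    ∫ x, p.eval x ∂(Measure.pi fun _ => ρ) = ν.expect fun x => p.eval x := by
  have degree_le {d} (hd : d ∈ p.support) (i : ι) := MvPolynomial.degreeOf_le_iff.1 (hp i) d hd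
  simp only [MvPolynomial.eval_eq', SignedLaw.expect_sum, SignedLaw.expect_const_mul]
  rw [integral_finsetSum]
  · refine sum_congr rfl fun d hd => ?_
    rw [integral_const_mul, integral_fintype_prod_eq_prod fun i (x : ℝ) => x ^ d i,
      ν.expect_prod fun i x => x ^ d i]
    congr 1
    exact prod_congr rfl fun i _ => h.integral_pow (degree_le hd i)
  · exact fun d hd => (Integrable.fintype_prod (f := fun i x => x ^ d i) fun i =>
      integrable_pow_of_memLp hρ (degree_le hd i)).const_mul _

end MvPolynomial

section GenericDeterminant

variable {V : Type*} [Fintype V] [DecidableEq V]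

/-- The determinant of the generic symmetric matrix, a polynomial in the entries, which are
indexed by unordered pairs. -/
noncomputable def symDet (V R : Type*) [Fintype V] [DecidableEq V] [CommRing R] :
    MvPolynomial (Sym2 V) R :=
  det (of fun i j => MvPolynomial.X s(i, j))

variable {R : Type*} [CommRing R]

theorem eval_symDet (y : Sym2 V → R) :
    (symDet V R).eval y = (of fun i j => y s(i, j)).det := by
  rw [symDet, RingHom.map_det]
  congr 1
  ext i j
  simp

theorem card_filter_perm_pair_eq_le_two (σ : Equiv.Perm V) (e : Sym2 V) :
    #{i | s(σ i, i) = e} ≤ 2 := by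
  induction e with
  | _ a b =>
    refine (card_le_card fun i hi => ?_).trans (card_le_two (a := a) (b := b))
    simp only [mem_filter, mem_univ, true_and, Sym2.eq_iff] at hi
    simp only [mem_insert, mem_singleton]
    tauto

theorem degreeOf_symDet_le_two [Nontrivial R] (e : Sym2 V) : (symDet V R).degreeOf e ≤ 2 := by
  rw [symDet, det_apply]
  refine (MvPolynomial.degreeOf_sum_le _ _ _).trans (Finset.sup_le fun σ _ => ?_)
  have unsigned : (∏ i, (MvPolynomial.X s(σ i, i) : MvPolynomial (Sym2 V) R)).degreeOf e ≤ 2 := by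
    refine (MvPolynomial.degreeOf_prod_le _ _ _).trans ?_
    simpa [MvPolynomial.degreeOf_X, eq_comm] using card_filter_perm_pair_eq_le_two σ e
  rcases Int.units_eq_one_or (Equiv.Perm.sign σ) with sign | sign
  · simpa [sign] using unsigned
  · simpa [sign, MvPolynomial.degreeOf_neg] using unsigned

theorem degreeOf_symDet_sq_le_four [Nontrivial R] (e : Sym2 V) :
    (symDet V R ^ 2).degreeOf e ≤ 4 :=
  (MvPolynomial.degreeOf_pow_le _ _ _).trans (Nat.mul_le_mul_left 2 (degreeOf_symDet_le_two e))

end GenericDeterminant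

namespace IsIIDSymmetric

variable {ρ : Measure ℝ} {Ω : Type*} [MeasurableSpace Ω] {P : Measure Ω} {n : ℕ}
  {X : Ω → Matrix (Fin n) (Fin n) ℝ}

theorem hasLaw_entries (hX : IsIIDSymmetric ρ P X) :
    HasLaw (fun ω (e : Sym2 (Fin n)) => X ω e.inf e.sup) (Measure.pi fun _ => ρ) P :=
  iIndepFun.hasLaw_pi (fun e => hX.hasLaw _ _ (Sym2.inf_le_sup e))
    (hX.indep.precomp Sym2.sortEquiv.injective)

theorem det_eq_eval_symDet (hX : IsIIDSymmetric ρ P X) (ω : Ω) :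
    (X ω).det = (symDet (Fin n) ℝ).eval fun e => X ω e.inf e.sup := by
  rw [eval_symDet]
  congr 1
  ext i j
  rcases le_total i j with h | h
  · simp [h]
  · simp [h, (hX.symm ω).apply]

variable [IsProbabilityMeasure ρ]

theorem integrable_det_sq (hX : IsIIDSymmetric ρ P X) (hρ : MemLp (id : ℝ → ℝ) 4 ρ) :
    Integrable (fun ω => (X ω).det ^ 2) P := by
  have integrable := integrable_mvPolynomial_eval hρ (degreeOf_symDet_sq_le_four (V := Fin n))
  rw [← hX.hasLaw_entries.map_eq] at integrable
  simpa only [hX.det_eq_eval_symDet, map_pow, Function.comp_def] using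
    integrable.comp_aemeasurable hX.hasLaw_entries.aemeasurable

theorem detMoment_two (hX : IsIIDSymmetric ρ P X) (hρ : MemLp (id : ℝ → ℝ) 4 ρ)
    {K : Type*} [Fintype K] {ν : SignedLaw K ℝ} (h : IsQuadrature ρ 4 ν) :
    detMoment 2 P X = ν.detSq (Fin n) := by
  have degree_le := degreeOf_symDet_sq_le_four (V := Fin n) (R := ℝ)
  have integrable := integrable_mvPolynomial_eval hρ degree_le
  calc detMoment 2 P X = ∫ y, (symDet (Fin n) ℝ ^ 2).eval y ∂(Measure.pi fun _ => ρ) := by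
        rw [← hX.hasLaw_entries.integral_comp integrable.aestronglyMeasurable]
        simp only [detMoment, hX.det_eq_eval_symDet, map_pow, Function.comp_def]
    _ = ν.expect fun y => (symDet (Fin n) ℝ ^ 2).eval y :=
        h.integral_mvPolynomial_eval hρ degree_le
    _ = ν.detSq (Fin n) := by
        simp only [map_pow, eval_symDet, SignedLaw.detSq, SignedLaw.symExpect, ← pow_two]

end IsIIDSymmetric

theorem SignedLaw.translate_neg_translate {K R : Type*} [CommRing R] (ν : SignedLaw K R) (c : R) :
    (ν.translate (-c)).translate c = ν := by
  simp only [translate, neg_add_cancel_right]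

theorem mainTheorem1 (ρ : Measure ℝ) [IsProbabilityMeasure ρ]
    (hρ : MemLp (id : ℝ → ℝ) 4 ρ)
    (m₁ μ₂ μ₃ μ₄ : ℝ)
    (hm₁ : m₁ = ∫ x, x ∂ρ)
    (hμ₂ : μ₂ = centralMoment id 2 ρ)
    (hμ₃ : μ₃ = centralMoment id 3 ρ)
    (hμ₄ : μ₄ = centralMoment id 4 ρ)
    (Ω : ℕ → Type*) [∀ n, MeasurableSpace (Ω n)]
    (P : ∀ n, Measure (Ω n)) [∀ n, IsProbabilityMeasure (P n)]
    (X : ∀ n, Ω n → Matrix (Fin n) (Fin n) ℝ)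
    (hX : ∀ n, IsIIDSymmetric ρ (P n) (X n)) :
    (∀ n, Integrable (fun ω => (X n ω).det ^ 2) (P n)) ∧
    ∀ t : ℝ, |μ₂ * t| < 1 →
      HasSum (fun n : ℕ => detMoment 2 (P n) (X n) * (t ^ n / (n.factorial : ℝ)))
        ((1 + 2 * m₁ * μ₃ * t ^ 2
            + m₁ ^ 2 * (μ₃ ^ 2 * t ^ 4 + t / (1 - μ₂ ^ 2 * t ^ 2)
                + 2 * μ₂ * t ^ 2 / (1 - μ₂ * t)))
          * (Real.exp ((μ₄ - 3 * μ₂ ^ 2) * t ^ 2 / 2 - μ₂ * t)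
              / ((1 - μ₂ * t) ^ 2 * Real.sqrt (1 - μ₂ ^ 2 * t ^ 2)))) := by
  refine ⟨fun n => (hX n).integrable_det_sq hρ, fun t ht => ?_⟩
  obtain ⟨ν, quadrature⟩ := exists_isQuadrature (N := 4) hρ
  have central {k : ℕ} (hk : k ≤ 4) := quadrature.moment_translate_neg_mean hk
  have centered := quadrature.isCentered_translate_neg_mean (by norm_num)
  rw [← hm₁] at central centered
  have hasEgf := centered.hasEgf_detSq_translate ((central (by norm_num)).trans hμ₂.symm)
    ((central (by norm_num)).trans hμ₃.symm) ((central (by norm_num)).trans hμ₄.symm) m₁ ht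
  simp only [SignedLaw.translate_neg_translate] at hasEgf
  simpa only [HasEgf, (hX _).detMoment_two hρ quadrature] using hasEgf
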